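/- Let $d\ge 0$ be an integer, let $\mathcal S$ be a non-empty compact metric space with its Borel $\sigma$-algebra, and let $\mathcal P(\mathcal S)$ be the set of Borel probability measures on $\mathcal S$ with the topology of weak convergence (the Prohorov topology). Let $H:\mathbb R^d\times\mathcal S\to\{\text{subsets of }\mathbb R^d\}$ be a set-valued map such that, for some $K>0$, - $H(x,s)$ is a non-empty, compact, convex subset of $\mathbb R^d$ for every $(x,s)\in\mathbb R^d\times\mathcal S$; - $\sup_{z\in H(x,s)}\|z\|\le K(1+\|x\|)$ for every $(x,s)\in\mathbb R^d\times\mathcal S$; - whenever $(x_n,s_n)\to(x,s)$ in $\mathbb R^d\times\mathcal S$, $z_n\in H(x_n,s_n)$ for all $n$, and $z_n\to z$, then $z\in H(x,s)$. Let $\Pi:\mathbb R^d\times\mathcal S\to\mathcal P(\mathcal S)$ be continuous. For $x\in\mathbb R^d$ let $$D(x)=\Big\{\mu\in\mathcal P(\mathcal S):\ \mu(A)=\int_{\mathcal S}\Pi(x,s)(A)\,\mu(ds)\ \text{ for every Borel set } A\subseteq\mathcal S\Big\}$$ be the set of stationary distributions of the Markov chain with transition kernel $\Pi(x,\cdot)(\cdot)$,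 put $H_x(s)=H(x,s)$, and let $$\hat H(x)=\bigcup_{\mu\in D(x)}\int_{\mathcal S}H_x(s)\,\mu(ds),$$ where $\int_{\mathcal S}H_x(s)\,\mu(ds)$ is Aumann's integral, i.e. the set of all $\int_{\mathcal S}f\,d\mu$ with $f:\mathcal S\to\mathbb R^d$ Borel measurable, $\mu$-integrable, and $f(s)\in H(x,s)$ for every $s\in\mathcal S$. Then $\hat H$ is a Marchaud map, with the same constant $K$: 1. for every $x\in\mathbb R^d$, $\sup_{z\in\hat H(x)}\|z\|\le K(1+\|x\|)$; 2. for every $x\in\mathbb R^d$, $\hat H(x)$ is a non-empty, convex and compact subset of $\mathbb R^d$; 3. for every sequence $x_n\to x$ in $\mathbb R^d$ and every sequence $z_n\in\hat H(x_n)$ with $z_n\to z$, we have $z\in\hat H(x)$. -/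

import Mathlib

open MeasureTheory Filter Topology

/-- Standing assumptions on the set-valued drift `H : ℝᵈ × S → {subsets of ℝᵈ}`:
non-empty compact convex values, linear growth with constant `K > 0` uniform in `s`,
and (sequentially) closed graph. -/
structure IsMarkovDrift {d : ℕ} {S : Type*} [TopologicalSpace S]
    (K : ℝ) (H : EuclideanSpace ℝ (Fin d) → S → Set (EuclideanSpace ℝ (Fin d))) : Prop where
  nonempty : ∀ x s, (H x s).Nonempty
  isCompact : ∀ x s, IsCompact (H x s)
  convex : ∀ x s, Convex ℝ (H x s)
  K_pos : 0 < K
  norm_le : ∀ x s, ∀ z ∈ H x s, ‖z‖ ≤ K * (1 + ‖x‖)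
  closed_graph : ∀ (x : ℕ → EuclideanSpace ℝ (Fin d)) (s : ℕ → S)
    (z : ℕ → EuclideanSpace ℝ (Fin d)) (x₀ : EuclideanSpace ℝ (Fin d)) (s₀ : S)
    (z₀ : EuclideanSpace ℝ (Fin d)),
    Tendsto (fun n => (x n, s n)) atTop (𝓝 (x₀, s₀)) → (∀ n, z n ∈ H (x n) (s n)) →
    Tendsto z atTop (𝓝 z₀) → z₀ ∈ H x₀ s₀

/-- `f` is a measurable selection of the set-valued map `F`. -/
def IsMeasurableSelection {Y E : Type*} [MeasurableSpace Y] [MeasurableSpace E]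
    (F : Y → Set E) (f : Y → E) : Prop :=
  Measurable f ∧ ∀ y, f y ∈ F y

/-- Aumann's integral of the set-valued map `F` with respect to `μ`: the set of the integrals
of all `μ`-integrable measurable selections of `F`. -/
def aumannIntegral {Y : Type*} [MeasurableSpace Y] {d : ℕ}
    (F : Y → Set (EuclideanSpace ℝ (Fin d))) (μ : Measure Y) :
    Set (EuclideanSpace ℝ (Fin d)) :=
  {z | ∃ f : Y → EuclideanSpace ℝ (Fin d),
    IsMeasurableSelection F f ∧ Integrable f μ ∧ ∫ y, f y ∂μ = z}

/-- The set `D(x)` of stationary distributions of the Markov chain with transition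
kernel `Q x`. -/
def stationaryDistributions {X S : Type*} [MeasurableSpace S]
    (Q : X × S → ProbabilityMeasure S) (x : X) : Set (ProbabilityMeasure S) :=
  {μ | ∀ A : Set S, MeasurableSet A →
    (μ : Measure S) A = ∫⁻ s, (Q (x, s) : Measure S) A ∂(μ : Measure S)}

/-- The averaged map `Ĥ(x) = ⋃_{μ ∈ D(x)} ∫ H(x, s) μ(ds)`. -/
def averagedMap {d : ℕ} {S : Type*} [MeasurableSpace S]
    (Q : EuclideanSpace ℝ (Fin d) × S → ProbabilityMeasure S)
    (H : EuclideanSpace ℝ (Fin d) → S → Set (EuclideanSpace ℝ (Fin d)))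
    (x : EuclideanSpace ℝ (Fin d)) : Set (EuclideanSpace ℝ (Fin d)) :=
  ⋃ μ ∈ stationaryDistributions Q x, aumannIntegral (H x) (μ : Measure S)

/-- `F` is a Marchaud map with linear growth constant `K`. -/
structure IsMarchaudMap {d : ℕ} (K : ℝ)
    (F : EuclideanSpace ℝ (Fin d) → Set (EuclideanSpace ℝ (Fin d))) : Prop where
  norm_le : ∀ x, ∀ z ∈ F x, ‖z‖ ≤ K * (1 + ‖x‖)
  nonempty : ∀ x, (F x).Nonempty
  convex : ∀ x, Convex ℝ (F x)
  isCompact : ∀ x, IsCompact (F x)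
  closed_graph : ∀ (x z : ℕ → EuclideanSpace ℝ (Fin d)) (x₀ z₀ : EuclideanSpace ℝ (Fin d)),
    Tendsto x atTop (𝓝 x₀) → (∀ n, z n ∈ F (x n)) → Tendsto z atTop (𝓝 z₀) → z₀ ∈ F x₀

/-! Points of `averagedMap Q H x` are exactly the barycenters `∫ p, p.2 ∂γ` of probability measures
`γ` on `S × ℝᵈ` carried by the graph of `H x` with stationary first marginal
(`mem_averagedMap_iff`): push `μ` forward along a selection, or conversely disintegrate `γ` and
average its fibres, which convexity keeps inside `H x s`. In this form no selection has to be
followed to a limit. Convexity comes from mixing the measures `γ`. For the closed graph, linear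
growth makes the `γ n` tight, and a weak limit keeps the carrier (portmanteau), the stationarity
(Feller property) and the barycenter (uniformly bounded support). Nonemptiness combines
Krylov–Bogolyubov with a least-norm selection. -/

open ProbabilityTheory Set
open scoped BoundedContinuousFunction

/-! ### Measurable selections by least norm -/

section Selection

variable {S : Type*} [TopologicalSpace S] [T2Space S] {E : Type*} [NormedAddCommGroup E]

theorem isClosed_setOf_inter_nonempty {F : S → Set E}
    (hF : IsCompact {p : S × E | p.2 ∈ F p.1}) {C : Set E} (hC : IsClosed C) :
    IsClosed {s | (F s ∩ C).Nonempty} := by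
  have : {s | (F s ∩ C).Nonempty} =
      Prod.fst '' ({p : S × E | p.2 ∈ F p.1} ∩ Prod.snd ⁻¹' C) := by
    ext s
    simp [Set.Nonempty]
  rw [this]
  exact ((hF.inter_right (hC.preimage continuous_snd)).image continuous_fst).isClosed

variable [InnerProductSpace ℝ E]

/-- In a convex set of an inner product space, two points of least norm coincide. -/
theorem Convex.eq_of_norm_le {C : Set E} (hC : Convex ℝ C) {z w : E}
    (hz : z ∈ C) (hw : w ∈ C) (hzmin : ∀ y ∈ C, ‖z‖ ≤ ‖y‖) (hwz : ‖w‖ ≤ ‖z‖) : z = w := by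
  have hmid : (1 / 2 : ℝ) • z + (1 / 2 : ℝ) • w ∈ C :=
    hC hz hw (by norm_num) (by norm_num) (by norm_num)
  have h1 := hzmin _ hmid
  rw [← smul_add, norm_smul, Real.norm_of_nonneg (by norm_num)] at h1
  have h2 := parallelogram_law_with_norm ℝ z w
  -- The midpoint gives `‖z + w‖ ≥ 2‖z‖`, so the parallelogram law leaves nothing for `‖z - w‖`.
  have h3 : ‖z - w‖ = 0 := by
    nlinarith [norm_nonneg (z - w), norm_nonneg z, norm_nonneg w, norm_nonneg (z + w)]
  exact sub_eq_zero.1 (norm_eq_zero.1 h3)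

variable [MeasurableSpace S] [BorelSpace S] [MeasurableSpace E] [BorelSpace E]

/-- A set-valued map with compact graph and nonempty compact convex values has a measurable
selection, namely the point of least norm. -/
theorem exists_isMeasurableSelection {F : S → Set E} (hne : ∀ s, (F s).Nonempty)
    (hco : ∀ s, IsCompact (F s)) (hcv : ∀ s, Convex ℝ (F s))
    (hF : IsCompact {p : S × E | p.2 ∈ F p.1}) : ∃ f, IsMeasurableSelection F f := by
  have hmin : ∀ s, ∃ z ∈ F s, ∀ y ∈ F s, ‖z‖ ≤ ‖y‖ := fun s ↦ by
    obtain ⟨z, hz, hzm⟩ := (hco s).exists_isMinOn (hne s) continuous_norm.continuousOn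
    exact ⟨z, hz, fun y hy ↦ hzm hy⟩
  choose f hfF hfmin using hmin
  refine ⟨f, measurable_of_isClosed fun C hC ↦ ?_, hfF⟩
  -- `f s ∈ C` iff the least norm on `F s ∩ C` is no larger than that on `F s`, by uniqueness of the
  -- minimiser. Testing rational radii makes this a countable condition on closed sets.
  have hpre : f ⁻¹' C = ⋂ q : ℚ, ({s | (F s ∩ Metric.closedBall 0 (q : ℝ)).Nonempty}ᶜ ∪
      {s | (F s ∩ (C ∩ Metric.closedBall 0 (q : ℝ))).Nonempty}) := by
    ext s
    simp only [mem_preimage, mem_iInter, mem_union, mem_compl_iff, mem_ofPred_eq]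
    constructor
    · intro hs q
      refine or_iff_not_imp_left.2 fun h ↦ ?_
      obtain ⟨z, hz, hzq⟩ := not_not.1 h
      refine ⟨f s, hfF s, hs, ?_⟩
      rw [mem_closedBall_zero_iff] at hzq ⊢
      exact (hfmin s z hz).trans hzq
    · intro h
      have key : ∀ q : ℚ, ‖f s‖ < q → ∃ z ∈ F s ∩ C, ‖z‖ ≤ q := fun q hq ↦ by
        rcases h q with h | ⟨z, hz, hzC, hzq⟩
        · exact absurd ⟨f s, hfF s, mem_closedBall_zero_iff.2 hq.le⟩ h
        · exact ⟨z, ⟨hz, hzC⟩, mem_closedBall_zero_iff.1 hzq⟩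
      obtain ⟨q₀, hq₀⟩ := exists_rat_gt ‖f s‖
      obtain ⟨z₀, hz₀, -⟩ := key q₀ hq₀
      obtain ⟨z, hz, hzm⟩ :=
        ((hco s).inter_right hC).exists_isMinOn ⟨z₀, hz₀⟩ continuous_norm.continuousOn
      have hle : ‖z‖ ≤ ‖f s‖ := by
        refine le_of_forall_lt_rat_imp_le fun q hq ↦ ?_
        obtain ⟨w, hw, hwq⟩ := key q hq
        exact (hzm hw).trans hwq
      rw [(hcv s).eq_of_norm_le (hfF s) hz.1 (hfmin s) hle]
      exact hz.2
  rw [hpre]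
  exact .iInter fun q ↦
    (isClosed_setOf_inter_nonempty hF Metric.isClosed_closedBall).measurableSet.compl.union
      (isClosed_setOf_inter_nonempty hF (hC.inter Metric.isClosed_closedBall)).measurableSet

end Selection

/-! ### Stationary distributions and weak limits -/

section Stationary

variable {S : Type*} [TopologicalSpace S] [TopologicalSpace.PseudoMetrizableSpace S]
  [MeasurableSpace S] [BorelSpace S]

/-- A weakly continuous family of probability measures is measurable for the Giry structure. -/
theorem measurable_toMeasure_of_continuous {T : Type*} [TopologicalSpace T] [MeasurableSpace T]
    [OpensMeasurableSpace T] {P : T → ProbabilityMeasure S} (hP : Continuous P) :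
    Measurable fun t ↦ (P t : Measure S) := by
  refine .measure_of_isPiSystem_of_isProbabilityMeasure
    (S := {U | IsOpen U}) BorelSpace.measurable_eq isPiSystem_isOpen fun U hU ↦ ?_
  -- By portmanteau the mass of an open set is lower semicontinuous in the measure.
  refine LowerSemicontinuous.measurable (lowerSemicontinuous_iff_le_liminf.2 fun t ↦ ?_)
  exact ProbabilityMeasure.le_liminf_measure_open_of_tendsto (hP.tendsto t) hU

variable {X : Type*} [TopologicalSpace X] {Q : X × S → ProbabilityMeasure S}

/-- The transition kernel with frozen parameter `x`. -/
noncomputable def frozenKernel (hQ : Continuous Q) (x : X) : Kernel S S :=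
  ⟨fun s ↦ (Q (x, s) : Measure S), measurable_toMeasure_of_continuous (hQ.comp (by fun_prop))⟩

instance (hQ : Continuous Q) (x : X) : IsMarkovKernel (frozenKernel hQ x) :=
  ⟨fun s ↦ inferInstanceAs (IsProbabilityMeasure (Q (x, s) : Measure S))⟩

theorem mem_stationaryDistributions_iff_bind (hQ : Continuous Q) {x : X}
    {μ : ProbabilityMeasure S} :
    μ ∈ stationaryDistributions Q x ↔
      (μ : Measure S) = (μ : Measure S).bind (frozenKernel hQ x) := by
  rw [Measure.ext_iff]
  refine forall₂_congr fun A hA ↦ ?_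
  rw [Measure.bind_apply hA (Kernel.aemeasurable _)]
  rfl

theorem integral_bind_frozenKernel (hQ : Continuous Q) (x : X) (μ : Measure S)
    [IsProbabilityMeasure μ] (φ : S →ᵇ ℝ) :
    ∫ y, φ y ∂(μ.bind (frozenKernel hQ x)) = ∫ s, ∫ y, φ y ∂(Q (x, s) : Measure S) ∂μ := by
  have h := φ.integrable (μ.bind (frozenKernel hQ x))
  rw [Measure.comp_eq_comp_const_apply] at h ⊢
  rw [Kernel.integral_comp h]
  rfl

/-- Bounded continuous functions separate finite measures. Unlike the setwise identity, this form
passes to weak limits. -/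
theorem mem_stationaryDistributions_iff (hQ : Continuous Q) {x : X} {μ : ProbabilityMeasure S} :
    μ ∈ stationaryDistributions Q x ↔ ∀ φ : S →ᵇ ℝ,
      ∫ s, φ s ∂(μ : Measure S) = ∫ s, ∫ y, φ y ∂(Q (x, s) : Measure S) ∂(μ : Measure S) := by
  simp_rw [mem_stationaryDistributions_iff_bind hQ, ← integral_bind_frozenKernel hQ x]
  refine ⟨fun h φ ↦ by rw [← h], fun h ↦ ?_⟩
  exact ext_of_forall_integral_eq_of_IsFiniteMeasure h

variable [SecondCountableTopology S] [TopologicalSpace.PseudoMetrizableSpace X]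
  [SecondCountableTopology X]

/-- The transition operator applied to a bounded continuous function, as a bounded continuous
function of the parameter and the state. -/
noncomputable def transitionIntegral (hQ : Continuous Q) (φ : S →ᵇ ℝ) : X × S →ᵇ ℝ :=
  .ofNormedAddCommGroup (fun p ↦ ∫ y, φ y ∂(Q p : Measure S))
    ((ProbabilityMeasure.continuous_integral_boundedContinuousFunction φ).comp hQ) ‖φ‖
    fun p ↦ by
      simpa using norm_integral_le_of_norm_le_const (μ := (Q p : Measure S))
        (ae_of_all _ φ.norm_coe_le_norm)

/-- Integrand and measure both vary with `n`. Integrating against `δ_{x n} ⊗ μ n` moves the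
variation into the measure and leaves one fixed test function on `X × S`. -/
theorem tendsto_integral_transition (hQ : Continuous Q) {x : ℕ → X} {x₀ : X}
    (hx : Tendsto x atTop (𝓝 x₀)) {μ : ℕ → ProbabilityMeasure S} {μ₀ : ProbabilityMeasure S}
    (hμ : Tendsto μ atTop (𝓝 μ₀)) (φ : S →ᵇ ℝ) :
    Tendsto (fun n ↦ ∫ s, ∫ y, φ y ∂(Q (x n, s) : Measure S) ∂(μ n : Measure S)) atTop
      (𝓝 (∫ s, ∫ y, φ y ∂(Q (x₀, s) : Measure S) ∂(μ₀ : Measure S))) := by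
  borelize X
  have h1 : Tendsto (fun n ↦ (diracProba (x n)).prod (μ n)) atTop
      (𝓝 ((diracProba x₀).prod μ₀)) :=
    (ProbabilityMeasure.continuous_prod.tendsto (diracProba x₀, μ₀)).comp
      (((continuous_diracProba.tendsto x₀).comp hx).prodMk_nhds hμ)
  have h2 := ProbabilityMeasure.tendsto_iff_forall_integral_tendsto.1 h1
    (transitionIntegral hQ φ)
  have h3 : ∀ (a : X) (ν : ProbabilityMeasure S),
      ∫ p, transitionIntegral hQ φ p ∂((diracProba a).prod ν : Measure (X × S)) =
        ∫ s, ∫ y, φ y ∂(Q (a, s) : Measure S) ∂(ν : Measure S) := fun a ν ↦ by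
    have : ((diracProba a : ProbabilityMeasure X) : Measure X) = Measure.dirac a := rfl
    rw [ProbabilityMeasure.toMeasure_prod, this, Measure.dirac_prod,
      integral_map (by fun_prop) (transitionIntegral hQ φ).continuous.aestronglyMeasurable]
    rfl
  simpa only [h3] using h2

/-- A weak limit of asymptotically stationary distributions is stationary. -/
theorem mem_stationaryDistributions_of_tendsto (hQ : Continuous Q) {x : ℕ → X} {x₀ : X}
    (hx : Tendsto x atTop (𝓝 x₀)) {μ : ℕ → ProbabilityMeasure S} {μ₀ : ProbabilityMeasure S}
    (hμ : Tendsto μ atTop (𝓝 μ₀))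
    (h : ∀ φ : S →ᵇ ℝ, Tendsto (fun n ↦ ∫ s, φ s ∂(μ n : Measure S) -
      ∫ s, ∫ y, φ y ∂(Q (x n, s) : Measure S) ∂(μ n : Measure S)) atTop (𝓝 0)) :
    μ₀ ∈ stationaryDistributions Q x₀ := by
  refine (mem_stationaryDistributions_iff hQ).2 fun φ ↦ sub_eq_zero.1 ?_
  exact tendsto_nhds_unique
    ((ProbabilityMeasure.tendsto_iff_forall_integral_tendsto.1 hμ φ).sub
      (tendsto_integral_transition hQ hx hμ φ)) (h φ)

end Stationary

/-! ### Existence of stationary distributions -/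

section Existence

variable {S : Type*} [TopologicalSpace S] [MeasurableSpace S] [BorelSpace S]

/-- Cesàro averages of a sequence of probability measures. -/
theorem exists_cesaro_average (m : ℕ → ProbabilityMeasure S) :
    ∃ ν : ℕ → ProbabilityMeasure S, ∀ n (g : S →ᵇ ℝ), ∫ s, g s ∂(ν n : Measure S) =
      (n + 1 : ℝ)⁻¹ * ∑ k ∈ Finset.range (n + 1), ∫ s, g s ∂(m k : Measure S) := by
  have hν : ∀ n : ℕ, IsProbabilityMeasure
      ((n + 1 : ENNReal)⁻¹ • ∑ k ∈ Finset.range (n + 1), (m k : Measure S)) := fun n ↦ ⟨by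
    simp only [Measure.smul_apply, Measure.finsetSum_apply, measure_univ, Finset.sum_const,
      Finset.card_range, smul_eq_mul, nsmul_eq_mul, mul_one]
    push_cast
    exact ENNReal.inv_mul_cancel (by simp) (by simp)⟩
  refine ⟨fun n ↦ ⟨_, hν n⟩, fun n g ↦ ?_⟩
  rw [ProbabilityMeasure.coe_mk, integral_smul_measure,
    integral_finsetSum_measure fun k _ ↦ g.integrable _, ENNReal.toReal_inv,
    ENNReal.toReal_add (by simp) (by simp)]
  simp

variable [TopologicalSpace.MetrizableSpace S] [CompactSpace S] [Nonempty S]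
  {X : Type*} [TopologicalSpace X] [TopologicalSpace.PseudoMetrizableSpace X]
  [SecondCountableTopology X] {Q : X × S → ProbabilityMeasure S}

/-- Krylov–Bogolyubov: a Feller kernel on a compact metrizable space has a stationary
distribution. -/
theorem stationaryDistributions_nonempty (hQ : Continuous Q) (x : X) :
    (stationaryDistributions Q x).Nonempty := by
  obtain ⟨m, hm⟩ : ∃ m : ℕ → ProbabilityMeasure S, ∀ k (φ : S →ᵇ ℝ),
      ∫ s, φ s ∂(m (k + 1) : Measure S) =
        ∫ s, ∫ y, φ y ∂(Q (x, s) : Measure S) ∂(m k : Measure S) := by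
    let step : ProbabilityMeasure S → ProbabilityMeasure S := fun ν ↦
      ⟨(ν : Measure S).bind (frozenKernel hQ x), inferInstance⟩
    refine ⟨fun k ↦ step^[k] (diracProba (Classical.arbitrary S)), fun k φ ↦ ?_⟩
    simp only [Function.iterate_succ_apply']
    exact integral_bind_frozenKernel hQ x _ φ
  obtain ⟨ν, hν⟩ := exists_cesaro_average m
  obtain ⟨ν₀, -, φ, hφ, hlim⟩ :=
    isCompact_univ.tendsto_subseq (x := ν) fun n ↦ mem_univ _
  refine ⟨ν₀, mem_stationaryDistributions_of_tendsto hQ (x := fun _ ↦ x) tendsto_const_nhds hlim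
    fun g ↦ ?_⟩
  let Pg : S →ᵇ ℝ := (transitionIntegral hQ g).compContinuous ⟨fun s ↦ (x, s), by fun_prop⟩
  -- The averaged differences telescope to the two end terms, each at most `‖g‖`, divided by `n +
  -- 1`.
  have hbound : ∀ n, ‖∫ s, g s ∂(ν n : Measure S) -
      ∫ s, ∫ y, g y ∂(Q (x, s) : Measure S) ∂(ν n : Measure S)‖ ≤
        2 * ‖g‖ * (1 / ((n : ℝ) + 1)) := fun n ↦ by
    have h1 : ∫ s, ∫ y, g y ∂(Q (x, s) : Measure S) ∂(ν n : Measure S) =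
        (n + 1 : ℝ)⁻¹ * ∑ k ∈ Finset.range (n + 1), ∫ s, g s ∂(m (k + 1) : Measure S) := by
      simp_rw [hm]
      exact hν n Pg
    have hle : ∀ k, ‖∫ s, g s ∂(m k : Measure S)‖ ≤ ‖g‖ := fun k ↦ by
      simpa using norm_integral_le_of_norm_le_const (μ := (m k : Measure S))
        (ae_of_all _ g.norm_coe_le_norm)
    rw [h1, hν, ← mul_sub, ← Finset.sum_sub_distrib,
      Finset.sum_range_sub' (fun k ↦ ∫ s, g s ∂(m k : Measure S)), norm_mul,
      Real.norm_of_nonneg (by positivity), mul_comm, one_div]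
    refine mul_le_mul_of_nonneg_right ?_ (by positivity)
    exact (norm_sub_le _ _).trans (by linarith [hle 0, hle (n + 1)])
  have hzero : Tendsto (fun n : ℕ ↦ 2 * ‖g‖ * (1 / ((n : ℝ) + 1))) atTop (𝓝 0) := by
    simpa using (tendsto_one_div_add_atTop_nhds_zero_nat (𝕜 := ℝ)).const_mul (2 * ‖g‖)
  exact (squeeze_zero_norm hbound hzero).comp hφ.tendsto_atTop

end Existence

/-! ### Aumann integrals as barycenters -/

section Aumann

variable {S : Type*} [TopologicalSpace S] [T2Space S] [CompactSpace S]
  [MeasurableSpace S] [BorelSpace S] {d : ℕ}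

/-- An element of the Aumann integral of a map with compact convex values is the barycenter of
a probability measure carried by the graph, and conversely. -/
theorem mem_aumannIntegral_iff {F : S → Set (EuclideanSpace ℝ (Fin d))}
    (hne : ∀ s, (F s).Nonempty) (hco : ∀ s, IsCompact (F s)) (hcv : ∀ s, Convex ℝ (F s))
    (hF : IsCompact {p : S × EuclideanSpace ℝ (Fin d) | p.2 ∈ F p.1})
    {R : ℝ} (hR : ∀ s, ∀ y ∈ F s, ‖y‖ ≤ R) {μ : Measure S} [IsProbabilityMeasure μ]
    {z : EuclideanSpace ℝ (Fin d)} :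
    z ∈ aumannIntegral F μ ↔ ∃ γ : Measure (S × EuclideanSpace ℝ (Fin d)),
      IsProbabilityMeasure γ ∧ (∀ᵐ p ∂γ, p.2 ∈ F p.1) ∧ γ.fst = μ ∧ ∫ p, p.2 ∂γ = z := by
  have hmeas : MeasurableSet {p : S × EuclideanSpace ℝ (Fin d) | p.2 ∈ F p.1} :=
    hF.isClosed.measurableSet
  constructor
  · rintro ⟨f, ⟨hfm, hfF⟩, -, rfl⟩
    have hg : Measurable fun s ↦ (s, f s) := measurable_id.prodMk hfm
    refine ⟨μ.map fun s ↦ (s, f s), Measure.isProbabilityMeasure_map hg.aemeasurable,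
      (ae_map_iff hg.aemeasurable hmeas).2 (ae_of_all _ hfF), ?_, ?_⟩
    · rw [Measure.fst_map_prodMk hfm, Measure.map_id']
    · rw [integral_map hg.aemeasurable (by fun_prop)]
  · rintro ⟨γ, hγ, hγF, rfl, rfl⟩
    obtain ⟨f₀, hf₀m, hf₀F⟩ := exists_isMeasurableSelection hne hco hcv hF
    have hint : Integrable (fun p ↦ p.2) γ :=
      .of_bound (by fun_prop) R (hγF.mono fun p hp ↦ hR _ _ hp)
    have hdis : γ.fst ⊗ₘ γ.condKernel = γ := Measure.disintegrate _ _
    -- The fibre means lie in the closed convex sets `F s`, but only for almost every `s`; the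
    -- selection `f₀` repairs the exceptional set.
    let g : S → EuclideanSpace ℝ (Fin d) := fun s ↦ ∫ y, y ∂(γ.condKernel s)
    have hgm : Measurable g :=
      (StronglyMeasurable.integral_kernel (κ := γ.condKernel) stronglyMeasurable_id).measurable
    have hgF : ∀ᵐ s ∂γ.fst, g s ∈ F s := by
      have h := hγF
      rw [← hdis] at h
      filter_upwards [Measure.ae_ae_of_ae_compProd h] with s hs
      exact (hcv s).integral_mem (hco s).isClosed hs
        (.of_bound (by fun_prop) R (hs.mono fun y hy ↦ hR _ _ hy))
    have hT : MeasurableSet {s | g s ∈ F s} := (measurable_id.prodMk hgm) hmeas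
    classical
    let f : S → EuclideanSpace ℝ (Fin d) := {s | g s ∈ F s}.piecewise g f₀
    have hfm : Measurable f := hgm.piecewise hT hf₀m
    have hfF : ∀ s, f s ∈ F s := fun s ↦ by
      by_cases hs : s ∈ {s | g s ∈ F s}
      · rw [show f s = g s from piecewise_eq_of_mem _ _ _ hs]
        exact hs
      · rw [show f s = f₀ s from piecewise_eq_of_notMem _ _ _ hs]
        exact hf₀F s
    refine ⟨f, ⟨hfm, hfF⟩, .of_bound (by fun_prop) R (ae_of_all _ fun s ↦ hR s _ (hfF s)), ?_⟩
    have hfg : f =ᵐ[γ.fst] g := hgF.mono fun s hs ↦ piecewise_eq_of_mem _ _ _ hs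
    rw [integral_congr_ae hfg]
    conv_rhs => rw [← hdis]
    rw [Measure.integral_compProd (by rwa [hdis])]

end Aumann

/-! ### Weak compactness with convergence of barycenters -/

section Compactness

variable {S : Type*} [TopologicalSpace S] [TopologicalSpace.MetrizableSpace S] [CompactSpace S]
  [MeasurableSpace S] [BorelSpace S] {d : ℕ}

/-- The truncated `i`-th coordinate of the second component. -/
noncomputable def truncatedCoord (S : Type*) [TopologicalSpace S] {d : ℕ} (R : ℝ) (i : Fin d) :
    S × EuclideanSpace ℝ (Fin d) →ᵇ ℝ :=
  .ofNormedAddCommGroup (fun p ↦ max (-R) (min R (p.2 i))) (by fun_prop) |R| fun p ↦ by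
    rw [Real.norm_eq_abs]
    refine abs_le.2 ⟨?_, max_le (neg_le_abs R) ((min_le_left _ _).trans (le_abs_self R))⟩
    exact (neg_le_neg (le_abs_self R)).trans (le_max_left _ _)

/-- A coordinate is unbounded, hence not a test function for weak convergence; the truncation is
one, and it is inactive where `‖p.2‖ ≤ R`. -/
theorem integral_truncatedCoord {R : ℝ} {γ : Measure (S × EuclideanSpace ℝ (Fin d))}
    [IsProbabilityMeasure γ] (h : ∀ᵐ p ∂γ, ‖p.2‖ ≤ R) (i : Fin d) :
    ∫ p, truncatedCoord S R i p ∂γ = (∫ p, p.2 ∂γ) i := by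
  have hint : Integrable (fun p ↦ p.2) γ := .of_bound (by fun_prop) R h
  have h1 := (EuclideanSpace.proj (𝕜 := ℝ) i).integral_comp_comm hint
  refine Eq.trans (integral_congr_ae (h.mono fun p hp ↦ ?_)) h1
  have hi := abs_le.1 ((PiLp.norm_apply_le p.2 i).trans hp)
  change max (-R) (min R (p.2 i)) = p.2 i
  rw [min_eq_right hi.2, max_eq_right hi.1]

/-- Probability measures carried by a fixed compact set `S × closedBall 0 R` converge along a
subsequence, together with their barycenters. -/
theorem exists_tendsto_subseq_of_ae_norm_le {R : ℝ}
    {γ : ℕ → ProbabilityMeasure (S × EuclideanSpace ℝ (Fin d))}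
    (h : ∀ n, ∀ᵐ p ∂(γ n : Measure (S × EuclideanSpace ℝ (Fin d))), ‖p.2‖ ≤ R) :
    ∃ (γ₀ : ProbabilityMeasure (S × EuclideanSpace ℝ (Fin d))) (φ : ℕ → ℕ), StrictMono φ ∧
      Tendsto (γ ∘ φ) atTop (𝓝 γ₀) ∧
      Tendsto (fun n ↦ ∫ p, p.2 ∂(γ (φ n) : Measure (S × EuclideanSpace ℝ (Fin d)))) atTop
        (𝓝 (∫ p, p.2 ∂(γ₀ : Measure (S × EuclideanSpace ℝ (Fin d))))) := by
  have htight : IsTightMeasureSet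
      {(η : Measure (S × EuclideanSpace ℝ (Fin d))) | η ∈ range γ} := by
    refine isTightMeasureSet_iff_exists_isCompact_measure_compl_le.2 fun ε _ ↦
      ⟨univ ×ˢ Metric.closedBall 0 R, isCompact_univ.prod (isCompact_closedBall 0 R), ?_⟩
    rintro _ ⟨_, ⟨n, rfl⟩, rfl⟩
    have hzero : (γ n : Measure (S × EuclideanSpace ℝ (Fin d)))
        (univ ×ˢ Metric.closedBall 0 R)ᶜ = 0 :=
      (h n).mono fun p hp ↦ ⟨mem_univ _, mem_closedBall_zero_iff.2 hp⟩
    simp [hzero]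
  obtain ⟨γ₀, -, φ, hφ, hlim⟩ := (isCompact_closure_of_isTightMeasureSet htight).tendsto_subseq
    fun n ↦ subset_closure (mem_range_self n)
  have hclosed : IsClosed {p : S × EuclideanSpace ℝ (Fin d) | ‖p.2‖ ≤ R} :=
    isClosed_le (by fun_prop) (by fun_prop)
  -- Full mass on a closed set survives the limit, so truncation is inactive for `γ₀` too.
  have hle := ProbabilityMeasure.limsup_measure_closed_le_of_tendsto hlim hclosed
  have hone : ∀ n, (γ n : Measure (S × EuclideanSpace ℝ (Fin d))) {p | ‖p.2‖ ≤ R} = 1 :=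
    fun n ↦ (prob_compl_eq_zero_iff hclosed.measurableSet).1 (h n)
  simp only [Function.comp_apply, hone, limsup_const] at hle
  have h₀ : ∀ᵐ p ∂(γ₀ : Measure (S × EuclideanSpace ℝ (Fin d))), ‖p.2‖ ≤ R :=
    (prob_compl_eq_zero_iff hclosed.measurableSet).2 (le_antisymm prob_le_one hle)
  refine ⟨γ₀, φ, hφ, hlim, ?_⟩
  refine ((PiLp.continuous_toLp 2 _).tendsto _).comp (tendsto_pi_nhds.2 fun i ↦ ?_)
  have hi := ProbabilityMeasure.tendsto_iff_forall_integral_tendsto.1 hlim (truncatedCoord S R i)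
  rw [integral_truncatedCoord h₀] at hi
  exact hi.congr fun n ↦ integral_truncatedCoord (h (φ n)) i

end Compactness

/-! ### The averaged map -/

section Averaged

variable {d : ℕ} {S : Type*} [MetricSpace S]
  {K : ℝ} {H : EuclideanSpace ℝ (Fin d) → S → Set (EuclideanSpace ℝ (Fin d))}

namespace IsMarkovDrift

theorem isClosed_graph (hH : IsMarkovDrift K H) :
    IsClosed {p : EuclideanSpace ℝ (Fin d) × S × EuclideanSpace ℝ (Fin d) |
      p.2.2 ∈ H p.1 p.2.1} := by
  refine IsSeqClosed.isClosed fun p p₀ hp hlim ↦ ?_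
  exact hH.closed_graph (fun n ↦ (p n).1) (fun n ↦ (p n).2.1) (fun n ↦ (p n).2.2) _ _ _
    (hlim.fst_nhds.prodMk_nhds hlim.snd_nhds.fst_nhds) hp hlim.snd_nhds.snd_nhds

theorem isCompact_graph [CompactSpace S] (hH : IsMarkovDrift K H) (x : EuclideanSpace ℝ (Fin d)) :
    IsCompact {p : S × EuclideanSpace ℝ (Fin d) | p.2 ∈ H x p.1} := by
  refine (isCompact_univ.prod (isCompact_closedBall 0 (K * (1 + ‖x‖)))).of_isClosed_subset
    (hH.isClosed_graph.preimage (f := fun p ↦ (x, p)) (by fun_prop)) fun p hp ↦ ?_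
  exact ⟨mem_univ _, mem_closedBall_zero_iff.2 (hH.norm_le _ _ _ hp)⟩

variable [MeasurableSpace S] {Q : EuclideanSpace ℝ (Fin d) × S → ProbabilityMeasure S}

theorem norm_le_of_mem_averagedMap (hH : IsMarkovDrift K H) {x z : EuclideanSpace ℝ (Fin d)}
    (hz : z ∈ averagedMap Q H x) : ‖z‖ ≤ K * (1 + ‖x‖) := by
  simp only [averagedMap, mem_iUnion, exists_prop] at hz
  obtain ⟨μ, -, f, hf, -, rfl⟩ := hz
  simpa using norm_integral_le_of_norm_le_const (μ := (μ : Measure S))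
    (ae_of_all _ fun s ↦ hH.norm_le x s _ (hf.2 s))

variable [CompactSpace S] [BorelSpace S]

theorem mem_averagedMap_iff (hH : IsMarkovDrift K H) {x z : EuclideanSpace ℝ (Fin d)} :
    z ∈ averagedMap Q H x ↔ ∃ μ ∈ stationaryDistributions Q x,
      ∃ γ : Measure (S × EuclideanSpace ℝ (Fin d)), IsProbabilityMeasure γ ∧
        (∀ᵐ p ∂γ, p.2 ∈ H x p.1) ∧ γ.fst = μ ∧ ∫ p, p.2 ∂γ = z := by
  simp only [averagedMap, mem_iUnion, exists_prop,
    mem_aumannIntegral_iff (hH.nonempty x) (hH.isCompact x) (hH.convex x) (hH.isCompact_graph x)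
      (hH.norm_le x)]

theorem averagedMap_nonempty [Nonempty S] (hH : IsMarkovDrift K H) (hQ : Continuous Q)
    (x : EuclideanSpace ℝ (Fin d)) : (averagedMap Q H x).Nonempty := by
  obtain ⟨μ, hμ⟩ := stationaryDistributions_nonempty hQ x
  obtain ⟨f, hfm, hfF⟩ := exists_isMeasurableSelection (hH.nonempty x) (hH.isCompact x)
    (hH.convex x) (hH.isCompact_graph x)
  exact ⟨_, mem_biUnion hμ ⟨f, ⟨hfm, hfF⟩, .of_bound (by fun_prop) _
    (ae_of_all _ fun s ↦ hH.norm_le x s _ (hfF s)), rfl⟩⟩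

/-- Stationarity, carrier, marginal and barycenter all respect mixtures of measures, so `γ₁` and
`γ₂` are mixed with weights `a` and `b`. -/
theorem convex_averagedMap (hH : IsMarkovDrift K H) (x : EuclideanSpace ℝ (Fin d)) :
    Convex ℝ (averagedMap Q H x) := by
  intro z₁ hz₁ z₂ hz₂ a b ha hb hab
  obtain ⟨μ₁, hμ₁, γ₁, hγ₁, hF₁, hfst₁, rfl⟩ := hH.mem_averagedMap_iff.1 hz₁
  obtain ⟨μ₂, hμ₂, γ₂, hγ₂, hF₂, hfst₂, rfl⟩ := hH.mem_averagedMap_iff.1 hz₂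
  have hsum : ENNReal.ofReal a + ENNReal.ofReal b = 1 := by
    rw [← ENNReal.ofReal_add ha hb, hab, ENNReal.ofReal_one]
  have hγ : IsProbabilityMeasure (ENNReal.ofReal a • γ₁ + ENNReal.ofReal b • γ₂) :=
    ⟨by simpa using hsum⟩
  have hμ : IsProbabilityMeasure
      (ENNReal.ofReal a • (μ₁ : Measure S) + ENNReal.ofReal b • (μ₂ : Measure S)) :=
    ⟨by simpa using hsum⟩
  refine hH.mem_averagedMap_iff.2 ⟨⟨_, hμ⟩, fun A hA ↦ ?_, _, hγ, ?_, ?_, ?_⟩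
  · simp only [ProbabilityMeasure.coe_mk, lintegral_add_measure, lintegral_smul_measure,
      Measure.add_apply, Measure.smul_apply]
    rw [← hμ₁ A hA, ← hμ₂ A hA]
  · exact ae_add_measure_iff.2 ⟨Measure.ae_smul_measure hF₁ _, Measure.ae_smul_measure hF₂ _⟩
  · simp only [Measure.fst, Measure.map_add _ _ measurable_fst, Measure.map_smul,
      ProbabilityMeasure.coe_mk] at hfst₁ hfst₂ ⊢
    rw [hfst₁, hfst₂]
  · have hint : ∀ γ : Measure (S × EuclideanSpace ℝ (Fin d)), IsProbabilityMeasure γ →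
        (∀ᵐ p ∂γ, p.2 ∈ H x p.1) → Integrable (fun p ↦ p.2) γ := fun γ _ h ↦
      .of_bound (by fun_prop) _ (h.mono fun p hp ↦ hH.norm_le _ _ _ hp)
    rw [integral_add_measure ((hint γ₁ hγ₁ hF₁).smul_measure ENNReal.ofReal_ne_top)
      ((hint γ₂ hγ₂ hF₂).smul_measure ENNReal.ofReal_ne_top), integral_smul_measure,
      integral_smul_measure, ENNReal.toReal_ofReal ha, ENNReal.toReal_ofReal hb]

/-- Weak limits of probability measures carried by the graphs of `H (x n)` are carried by the
graph of `H x₀`. -/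
theorem ae_mem_of_tendsto (hH : IsMarkovDrift K H) {x : ℕ → EuclideanSpace ℝ (Fin d)}
    {x₀ : EuclideanSpace ℝ (Fin d)} (hx : Tendsto x atTop (𝓝 x₀))
    {γ : ℕ → ProbabilityMeasure (S × EuclideanSpace ℝ (Fin d))}
    {γ₀ : ProbabilityMeasure (S × EuclideanSpace ℝ (Fin d))} (hγ : Tendsto γ atTop (𝓝 γ₀))
    (h : ∀ n, ∀ᵐ p ∂(γ n : Measure (S × EuclideanSpace ℝ (Fin d))), p.2 ∈ H (x n) p.1) :
    ∀ᵐ p ∂(γ₀ : Measure (S × EuclideanSpace ℝ (Fin d))), p.2 ∈ H x₀ p.1 := by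
  have hG := hH.isClosed_graph
  set G := {p : EuclideanSpace ℝ (Fin d) × S × EuclideanSpace ℝ (Fin d) | p.2.2 ∈ H p.1 p.2.1}
  -- The carriers vary with `n`; adjoining `δ_{x n}` as a further factor places all the measures on
  -- the single closed set `G`.
  have hprod : ∀ (a : EuclideanSpace ℝ (Fin d))
      (η : ProbabilityMeasure (S × EuclideanSpace ℝ (Fin d))),
      ((diracProba a).prod η : Measure _) G =
        (η : Measure (S × EuclideanSpace ℝ (Fin d))) {p | p.2 ∈ H a p.1} := fun a η ↦ by
    have : ((diracProba a : ProbabilityMeasure _) : Measure _) = Measure.dirac a := rfl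
    rw [ProbabilityMeasure.toMeasure_prod, this, Measure.dirac_prod,
      Measure.map_apply (by fun_prop) hG.measurableSet]
    rfl
  have hlim : Tendsto (fun n ↦ (diracProba (x n)).prod (γ n)) atTop
      (𝓝 ((diracProba x₀).prod γ₀)) :=
    (ProbabilityMeasure.continuous_prod.tendsto (diracProba x₀, γ₀)).comp
      (((continuous_diracProba.tendsto x₀).comp hx).prodMk_nhds hγ)
  have hle := ProbabilityMeasure.limsup_measure_closed_le_of_tendsto hlim hG
  have hone : ∀ n, (γ n : Measure (S × EuclideanSpace ℝ (Fin d))) {p | p.2 ∈ H (x n) p.1} = 1 :=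
    fun n ↦ (prob_compl_eq_zero_iff (hH.isCompact_graph _).isClosed.measurableSet).1 (h n)
  simp only [hprod, hone, limsup_const] at hle
  exact (prob_compl_eq_zero_iff (hH.isCompact_graph _).isClosed.measurableSet).2
    (le_antisymm prob_le_one hle)

theorem averagedMap_closed_graph (hH : IsMarkovDrift K H) (hQ : Continuous Q)
    (x z : ℕ → EuclideanSpace ℝ (Fin d)) (x₀ z₀ : EuclideanSpace ℝ (Fin d))
    (hx : Tendsto x atTop (𝓝 x₀)) (hz : ∀ n, z n ∈ averagedMap Q H (x n))
    (hzlim : Tendsto z atTop (𝓝 z₀)) : z₀ ∈ averagedMap Q H x₀ := by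
  choose μ hμ γ hγ hF hfst hint using fun n ↦ hH.mem_averagedMap_iff.1 (hz n)
  -- A common bound on the `x n` puts every `γ n` on one compact set `S × closedBall 0 (K * (1 +
  -- r))`.
  obtain ⟨r, hr⟩ := (Metric.isBounded_range_of_tendsto x hx).exists_norm_le
  have hbound : ∀ n, ∀ᵐ p ∂(γ n), ‖p.2‖ ≤ K * (1 + r) := fun n ↦ (hF n).mono fun p hp ↦
    (hH.norm_le _ _ _ hp).trans (mul_le_mul_of_nonneg_left
      (by linarith [hr (x n) (mem_range_self n)]) hH.K_pos.le)
  obtain ⟨γ₀, φ, hφ, hlim, hlimint⟩ :=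
    exists_tendsto_subseq_of_ae_norm_le (γ := fun n ↦ ⟨γ n, hγ n⟩) hbound
  have hxφ := hx.comp hφ.tendsto_atTop
  have hμlim : Tendsto (μ ∘ φ) atTop (𝓝 (γ₀.map measurable_fst.aemeasurable)) := by
    have hμeq : ∀ n, μ n =
        ProbabilityMeasure.map ⟨γ n, hγ n⟩ measurable_fst.aemeasurable := fun n ↦
      ProbabilityMeasure.toMeasure_injective (hfst n).symm
    rw [funext hμeq]
    exact ProbabilityMeasure.tendsto_map_of_tendsto_of_continuous _ _ hlim continuous_fst
  refine hH.mem_averagedMap_iff.2 ⟨_, mem_stationaryDistributions_of_tendsto hQ hxφ hμlim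
    fun g ↦ ?_, γ₀, inferInstance, hH.ae_mem_of_tendsto hxφ hlim fun n ↦ hF (φ n), rfl, ?_⟩
  · refine tendsto_const_nhds.congr fun n ↦ ?_
    exact (sub_eq_zero.2 ((mem_stationaryDistributions_iff hQ).1 (hμ (φ n)) g)).symm
  · refine tendsto_nhds_unique hlimint ?_
    simp only [ProbabilityMeasure.coe_mk, hint]
    exact hzlim.comp hφ.tendsto_atTop

end IsMarkovDrift

end Averaged

theorem mainTheorem6 {d : ℕ} {S : Type*} [MetricSpace S] [CompactSpace S] [Nonempty S]
    [MeasurableSpace S] [BorelSpace S] (K : ℝ)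
    (H : EuclideanSpace ℝ (Fin d) → S → Set (EuclideanSpace ℝ (Fin d)))
    (hH : IsMarkovDrift K H)
    (Q : EuclideanSpace ℝ (Fin d) × S → ProbabilityMeasure S) (hQ : Continuous Q) :
    IsMarchaudMap K (averagedMap Q H) where
  norm_le _ _ hz := hH.norm_le_of_mem_averagedMap hz
  nonempty := hH.averagedMap_nonempty hQ
  convex := hH.convex_averagedMap
  isCompact x := by
    -- Closedness of a single value is the closed graph property along a constant sequence.
    refine Metric.isCompact_of_isClosed_isBounded (IsSeqClosed.isClosed fun z z₀ hz hlim ↦ ?_)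
      (isBounded_iff_forall_norm_le.2 ⟨_, fun z hz ↦ hH.norm_le_of_mem_averagedMap hz⟩)
    exact hH.averagedMap_closed_graph hQ (fun _ ↦ x) z x z₀ tendsto_const_nhds hz hlim
  closed_graph := hH.averagedMap_closed_graph hQ
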